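/- **Conventions.** For a real normed space $V$ and $\varepsilon\in(0,2]$, the modulus of convexity is $$\delta_V(\varepsilon)=\inf\Big\{1-\Big\|\frac{v+w}{2}\Big\|\;:\;v,w\in V,\ \|v\|=\|w\|=1,\ \|v-w\|\ge\varepsilon\Big\}\in[0,1],$$ where the infimum is taken in $[0,1]$ (so it equals $1$ if there are no such pairs), and $V$ is *uniformly convex* if $\delta_V(\varepsilon)>0$ for every $\varepsilon\in(0,2]$. Let $(X,\Sigma,\mathfrak m)$ be a $\sigma$-finite measure space and $\mathbb B$ a separable real Banach space. A *measurable Banach $\mathbb B$-bundle* $\mathbf E$ over $X$ assigns to each $x\in X$ a closed linear subspace $\mathbf E(x)\subseteq\mathbb B$ such that $\{x:\mathbf E(x)\cap U\neq\varnothing\}\in\Sigma$ for every open $U\subseteq\mathbb B$. For $p\in(1,\infty)$, $\Gamma_p(\mathbf E)$ is the Banach space of all strongly measurable maps $v\colon X\to\mathbb B$ with $v(x)\in\mathbf E(x)$ for every $x$ and $\int\|v(x)\|^p\,d\mathfrak m<\infty$, modulo $\mathfrak m$-a.e. equality, with norm $\big(\int\|v(x)\|^p\,d\mathfrak m\big)^{1/p}$.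 For $f\colon X\to\mathbb R$, $\operatorname{ess\,inf} f=\sup\{\lambda\in[-\infty,\infty]: f\ge\lambda\ \mathfrak m\text{-a.e.}\}$. **Theorem.** There exist, for every $p\in(1,\infty)$, a function $\phi_p\colon(0,2]\times(0,1]\to(0,1]$ depending only on $p$, continuous and non-decreasing in each variable, extended by $\phi_p(\varepsilon,0):=0$, such that the following holds for every $\sigma$-finite measure space $(X,\Sigma,\mathfrak m)$, every separable real Banach space $\mathbb B$ and every measurable Banach $\mathbb B$-bundle $\mathbf E$ over $X$. The following two conditions are equivalent: 1. $\mathbf E(x)$ is uniformly convex for $\mathfrak m$-a.e. $x\in X$, and $\operatorname{ess\,inf}_{x}\delta_{\mathbf E(x)}(\varepsilon)>0$ for every $\varepsilon\in(0,2]$; 2. $\Gamma_p(\mathbf E)$ is uniformly convex for every $p\in(1,\infty)$. Moreover, for every $p\in(1,\infty)$ and every $\varepsilon\in(0,2]$, $$\operatorname*{ess\,inf}_{x}\,\phi_p\big(\varepsilon,\delta_{\mathbf E(x)}(\varepsilon/5)\big)\;\le\;\delta_{\Gamma_p(\mathbf E)}(\varepsilon)\;\le\;\operatorname*{ess\,inf}_{x}\,\delta_{\mathbf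 E(x)}(\varepsilon),$$ where for the first inequality it is assumed that $\mathfrak m\neq0$. -/

import Mathlib

open MeasureTheory Set Filter TopologicalSpace
open scoped ENNReal Topology

universe u v

noncomputable section

/-- The modulus of convexity `δ_V(ε)` of a real normed space `V`: the infimum, taken in `[0, 1]`, of
`1 - ‖(v + w) / 2‖` over all unit vectors `v`, `w` with `‖v - w‖ ≥ ε`. The element `1` is inserted so
that an infimum over no pairs at all is the top element `1` of `[0, 1]` (it changes nothing when such
pairs exist, because all the values are at most `1`). -/
def modulusOfConvexity (V : Type*) [SeminormedAddCommGroup V] [NormedSpace ℝ V] (ε : ℝ) : ℝ :=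
  sInf (insert 1 {r : ℝ | ∃ v w : V, ‖v‖ = 1 ∧ ‖w‖ = 1 ∧ ε ≤ ‖v - w‖ ∧
    r = 1 - ‖(2⁻¹ : ℝ) • (v + w)‖})

/-- `V` is uniformly convex: `δ_V(ε) > 0` for every `ε ∈ (0, 2]`. -/
def IsUniformlyConvex (V : Type*) [SeminormedAddCommGroup V] [NormedSpace ℝ V] : Prop :=
  ∀ ε ∈ Ioc (0 : ℝ) 2, 0 < modulusOfConvexity V ε

/-- A Banach `B`-bundle on the measurable space `X`: a weakly measurable multivalued map from `X` to
`B` whose values are closed linear subspaces of `B`. -/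
structure BanachBundle (X : Type*) [MeasurableSpace X] (B : Type*) [NormedAddCommGroup B]
    [NormedSpace ℝ B] where
  /-- the fiber `E(x)` over the point `x` -/
  fiber : X → Submodule ℝ B
  isClosed_fiber : ∀ x, IsClosed (fiber x : Set B)
  weaklyMeasurable : ∀ U : Set B, IsOpen U → MeasurableSet {x | ((fiber x : Set B) ∩ U).Nonempty}

namespace BanachBundle

variable {X : Type*} [MeasurableSpace X] {B : Type*} [NormedAddCommGroup B] [NormedSpace ℝ B]

/-- A section of the bundle: a strongly measurable map `v` with `v(x) ∈ E(x)` for all `x`. -/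
def IsSection (E : BanachBundle X B) (v : X → B) : Prop :=
  StronglyMeasurable v ∧ ∀ x, v x ∈ E.fiber x

/-- The space `Γ_p(E)` of `p`-integrable sections modulo a.e. equality, as a subspace of the
Lebesgue–Bochner space `L^p(μ; B)`, whose norm it inherits. -/
def sectionSpace (E : BanachBundle X B) (p : ℝ≥0∞) (μ : Measure X) : Submodule ℝ (Lp B p μ) where
  carrier := {f | ∃ v : X → B, E.IsSection v ∧ f =ᵐ[μ] v}
  zero_mem' := ⟨0, ⟨stronglyMeasurable_zero, fun x => (E.fiber x).zero_mem⟩, Lp.coeFn_zero B p μ⟩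
  add_mem' := by
    rintro f g ⟨v, hv, hf⟩ ⟨w, hw, hg⟩
    exact ⟨v + w, ⟨hv.1.add hw.1, fun x => (E.fiber x).add_mem (hv.2 x) (hw.2 x)⟩,
      (Lp.coeFn_add f g).trans (hf.add hg)⟩
  smul_mem' := by
    rintro c f ⟨v, hv, hf⟩
    exact ⟨c • v, ⟨hv.1.const_smul c, fun x => (E.fiber x).smul_mem c (hv.2 x)⟩,
      (Lp.coeFn_smul c f).trans (hf.const_smul c)⟩

/-- The bundle is uniformly convex: almost every fiber is a uniformly convex space. -/
def IsUniformlyConvexBundle (E : BanachBundle X B) (μ : Measure X) : Prop :=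
  ∀ᵐ x ∂μ, IsUniformlyConvex (E.fiber x)

/-- The essential infimum, in the extended reals, of a real-valued function. -/
def essInfReal (μ : Measure X) (f : X → ℝ) : EReal :=
  essInf (fun x => (f x : EReal)) μ

theorem mem_sectionSpace_iff (E : BanachBundle X B) {p : ℝ≥0∞} {μ : Measure X} (f : Lp B p μ) :
    f ∈ E.sectionSpace p μ ↔ ∀ᵐ x ∂μ, f x ∈ E.fiber x := by
  constructor
  · rintro ⟨v, hv, hf⟩
    filter_upwards [hf] with x hx
    rw [hx]
    exact hv.2 x
  · intro h
    obtain ⟨N, hN, hNm, hN0⟩ := exists_measurable_superset_of_null (ae_iff.1 h)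
    refine ⟨Nᶜ.indicator f, ⟨(Lp.stronglyMeasurable f).indicator hNm.compl, fun x => ?_⟩, ?_⟩
    · by_cases hx : x ∈ N
      · simp [hx]
      · have : f x ∈ E.fiber x := by
          by_contra hc
          exact hx (hN hc)
        simpa [hx] using this
    · have : ∀ᵐ x ∂μ, x ∉ N := measure_eq_zero_iff_ae_notMem.1 hN0
      filter_upwards [this] with x hx
      simp [hx]

/-- `Γ_p(E)` is a Banach space. -/
instance instCompleteSpaceSectionSpace [CompleteSpace B] (E : BanachBundle X B) (p : ℝ≥0∞)
    [Fact (1 ≤ p)] (μ : Measure X) : CompleteSpace (E.sectionSpace p μ) := by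
  refine IsClosed.completeSpace_coe (hs := ?_)
  refine isSeqClosed_iff_isClosed.1 fun u f hu hf => ?_
  obtain ⟨ns, -, h⟩ := (tendstoInMeasure_of_tendsto_Lp hf).exists_seq_tendsto_ae
  refine (E.mem_sectionSpace_iff f).2 ?_
  have h' : ∀ᵐ x ∂μ, ∀ n, u n x ∈ E.fiber x :=
    ae_all_iff.2 fun n => (E.mem_sectionSpace_iff _).1 (hu n)
  filter_upwards [h, h'] with x hx hx'
  exact (E.isClosed_fiber x).mem_of_tendsto hx (Eventually.of_forall fun i => hx' (ns i))

end BanachBundle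

end

/-!
The lower bound for `δ_Γ(ε)` rests on an inequality in a single fiber, `norm_midpoint_rpow_add_le`:
with `S = (‖v‖ ^ q + ‖w‖ ^ q) / 2` and some `γ > 0` depending only on `q` and `ε`, every pair `v`,
`w` in a space `V` with `δ_V(ε / 5) ≥ t` satisfies

  `‖(v + w) / 2‖ ^ q + t γ 2 ^ (-q) (‖v - w‖ ^ q - ε ^ q / 2 * S) ≤ S`.

Where the bracket is not negative, `‖v - w‖ ≥ ε / 4 * max ‖v‖ ‖w‖`. If then the norms are within a
factor `1 - ε / 20`, the normalized vectors are at distance at least `ε / 5`, and the modulus of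
convexity gives the gain; otherwise the strict convexity of the `q`-th power gives it. Integrating
over a pair of unit vectors of `Γ_q` at distance at least `ε` yields a lower bound linear in `t`, so
that `φ_q(ε, t) = t * m_q(ε)`, and the essential infimum is handled by dividing by `m_q(ε)`.

For the upper bound, suppose that fibers over a set of points that is not null contain pairs of unit
vectors at distance at least `ε` with midpoints of norm at least `1 - s`. Measurable pairs of this
kind over a set of positive measure, cut down to finite measure and multiplied by a constant, form
such a pair in `Γ_p`. The conditions on the pair are closed but not open and cannot be relaxed (`δ`
may jump at `ε = 2`), so the set of points is in general only analytic and dense sequences of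
sections do not suffice. It is however the projection of a Souslin scheme of measurable sets, in
which a state at level `k` is a point of a dense sequence of `B × B` known up to `2 ^ (-k)`. By the
argument for capacitability of analytic sets, `exists_bound_measure_ne_zero`, finitely many states
at each level already account for positive measure, and in a finitely branching scheme the leftmost
infinite branch depends measurably on the point, `exists_measurable_branch`.
-/

/-! ### The modulus of convexity -/

section Modulus

variable {V : Type*} [SeminormedAddCommGroup V] [NormedSpace ℝ V] {ε t : ℝ}

theorem le_modulusOfConvexity_iff :
    t ≤ modulusOfConvexity V ε ↔
      t ≤ 1 ∧ ∀ v w : V, ‖v‖ = 1 → ‖w‖ = 1 → ε ≤ ‖v - w‖ → t ≤ 1 - ‖(2⁻¹ : ℝ) • (v + w)‖ := by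
  have hb : BddBelow (insert 1 {r : ℝ | ∃ v w : V, ‖v‖ = 1 ∧ ‖w‖ = 1 ∧ ε ≤ ‖v - w‖ ∧
      r = 1 - ‖(2⁻¹ : ℝ) • (v + w)‖}) := by
    refine ⟨0, ?_⟩
    rintro r (rfl | ⟨v, w, hv, hw, -, rfl⟩)
    · exact zero_le_one
    · rw [norm_smul, Real.norm_of_nonneg (by norm_num)]
      linarith [norm_add_le v w]
  rw [modulusOfConvexity, le_csInf_iff hb (insert_nonempty _ _)]
  constructor
  · exact fun h => ⟨h 1 (mem_insert _ _), fun v w hv hw hvw =>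
      h _ (mem_insert_of_mem _ ⟨v, w, hv, hw, hvw, rfl⟩)⟩
  · rintro ⟨h1, h⟩ r (rfl | ⟨v, w, hv, hw, hvw, rfl⟩)
    · exact h1
    · exact h v w hv hw hvw

theorem modulusOfConvexity_le_one : modulusOfConvexity V ε ≤ 1 :=
  (le_modulusOfConvexity_iff.1 le_rfl).1

theorem modulusOfConvexity_nonneg : 0 ≤ modulusOfConvexity V ε := by
  refine le_modulusOfConvexity_iff.2 ⟨zero_le_one, fun v w hv hw _ => ?_⟩
  rw [norm_smul, Real.norm_of_nonneg (by norm_num)]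
  linarith [norm_add_le v w]

theorem modulusOfConvexity_mono : Monotone (modulusOfConvexity V) := by
  intro a b hab
  have h := le_modulusOfConvexity_iff.1 (le_refl (modulusOfConvexity V a))
  exact le_modulusOfConvexity_iff.2 ⟨h.1, fun v w hv hw hvw => h.2 v w hv hw (hab.trans hvw)⟩

theorem exists_of_modulusOfConvexity_lt (ht : t ≤ 1) (h : modulusOfConvexity V ε < t) :
    ∃ v w : V, ‖v‖ = 1 ∧ ‖w‖ = 1 ∧ ε ≤ ‖v - w‖ ∧ 1 - t ≤ ‖(2⁻¹ : ℝ) • (v + w)‖ := by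
  by_contra! hc
  refine h.not_ge (le_modulusOfConvexity_iff.2 ⟨ht, fun v w hv hw hvw => ?_⟩)
  linarith [hc v w hv hw hvw]

end Modulus

/-! ### Strict convexity of the power function -/

/-- The ratio `((1 + r) / 2) ^ q / ((1 + r ^ q) / 2)` between the `q`-th power of the mean of `1`
and `r` and the mean of their `q`-th powers. -/
noncomputable def powerMeanRatio (q r : ℝ) : ℝ := ((1 + r) / 2) ^ q / ((1 + r ^ q) / 2)

theorem powerMeanRatio_lt_one {q r : ℝ} (hq : 1 < q) (hr : 0 ≤ r) (hr1 : r < 1) :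
    powerMeanRatio q r < 1 := by
  have h := (strictConvexOn_rpow hq).2 (mem_Ici.2 (zero_le_one (α := ℝ))) (mem_Ici.2 hr) hr1.ne'
    (one_half_pos (α := ℝ)) one_half_pos (add_halves 1)
  have h0 := Real.rpow_nonneg hr q
  rw [powerMeanRatio, div_lt_one (by positivity)]
  simp only [smul_eq_mul, Real.one_rpow] at h
  convert h using 1
  · congr 1; ring
  · ring

/-- Rescaling `(1, r)` to the sum of `(1, s)`, `r ≤ s ≤ 1`, gives a more spread out pair, with the
larger sum of `q`-th powers by convexity. -/
theorem powerMeanRatio_monotoneOn {q : ℝ} (hq : 1 < q) :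
    MonotoneOn (powerMeanRatio q) (Icc 0 1) := by
  intro r hr s hs hrs
  obtain ⟨hr0, hr1⟩ := hr
  obtain ⟨hs0, hs1⟩ := hs
  rcases hr1.eq_or_lt with rfl | hr1
  · rw [le_antisymm hrs hs1]
  have hr0' := Real.rpow_nonneg hr0 q
  have hs0' := Real.rpow_nonneg hs0 q
  set c := (1 + s) / (1 + r) with hc
  have hcr : c * (1 + r) = 1 + s := by rw [hc]; field_simp
  have hc1 : 1 ≤ c := by rw [hc, one_le_div (by positivity)]; linarith
  have hcr1 : c * r ≤ s := by linarith
  have hlt : 0 < c - c * r := by nlinarith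
  have key : 1 + s ^ q ≤ c ^ q * (1 + r ^ q) := by
    set a := (1 - c * r) / (c - c * r) with ha
    have ha0 : 0 ≤ a := div_nonneg (by linarith) hlt.le
    have ha1 : a ≤ 1 := by rw [ha, div_le_one hlt]; linarith
    have haa : a * (c - c * r) = 1 - c * r := by rw [ha]; field_simp
    have hcc : c ∈ Ici (0 : ℝ) := mem_Ici.2 (by linarith)
    have hccr : c * r ∈ Ici (0 : ℝ) := mem_Ici.2 (by positivity)
    have h1 := (convexOn_rpow hq.le).2 hcc hccr ha0 (sub_nonneg.2 ha1) (by ring)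
    have h2 := (convexOn_rpow hq.le).2 hccr hcc ha0 (sub_nonneg.2 ha1) (by ring)
    simp only [smul_eq_mul] at h1 h2
    rw [show a * c + (1 - a) * (c * r) = 1 by linarith, Real.one_rpow] at h1
    rw [show a * (c * r) + (1 - a) * c = s by linarith] at h2
    rw [Real.mul_rpow (by linarith) hr0] at h1 h2
    linarith
  rw [powerMeanRatio, powerMeanRatio, div_le_div_iff₀ (by positivity) (by positivity),
    show (1 + s) / 2 = c * ((1 + r) / 2) by rw [← hcr]; ring,
    Real.mul_rpow (by linarith) (by positivity)]
  have : 0 ≤ ((1 + r) / 2) ^ q := by positivity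
  nlinarith [mul_le_mul_of_nonneg_left key this]

theorem half_add_rpow_le {q a b : ℝ} (hq : 1 < q) (ha : 0 ≤ a) (hb : 0 ≤ b) :
    ((a + b) / 2) ^ q ≤ (a ^ q + b ^ q) / 2 := by
  have h := (convexOn_rpow hq.le).2 (mem_Ici.2 ha) (mem_Ici.2 hb)
    (one_half_pos (α := ℝ)).le one_half_pos.le (add_halves 1)
  simp only [smul_eq_mul] at h
  rw [show (a + b) / 2 = 1 / 2 * a + 1 / 2 * b by ring]
  linarith

theorem half_add_rpow_le_powerMeanRatio {q a b r : ℝ} (hq : 1 < q) (ha : 0 < a) (hb : 0 ≤ b)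
    (hr : r ∈ Icc (0 : ℝ) 1) (hba : b ≤ r * a) :
    ((a + b) / 2) ^ q ≤ powerMeanRatio q r * ((a ^ q + b ^ q) / 2) := by
  have hs0 : 0 ≤ b / a := by positivity
  have hsr : b / a ≤ r := (div_le_iff₀ ha).2 hba
  have hm := powerMeanRatio_monotoneOn hq ⟨hs0, hsr.trans hr.2⟩ hr hsr
  have hpos : 0 < (1 + (b / a) ^ q) / 2 := by positivity
  rw [powerMeanRatio, div_le_iff₀ hpos] at hm
  have e1 : (a + b) / 2 = a * ((1 + b / a) / 2) := by field_simp
  have e2 : a ^ q + b ^ q = a ^ q * (1 + (b / a) ^ q) := by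
    rw [Real.div_rpow hb ha.le]
    have : a ^ q ≠ 0 := (Real.rpow_pos_of_pos ha q).ne'
    field_simp
  rw [e1, Real.mul_rpow ha.le (by positivity), e2]
  calc _ ≤ a ^ q * (powerMeanRatio q r * ((1 + (b / a) ^ q) / 2)) := by gcongr
    _ = _ := by ring

/-! ### The convexity gain in a single fiber -/

/-- The constant `γ` for which `‖(v + w) / 2‖ ^ q ≤ (1 - t * γ) * (‖v‖ ^ q + ‖w‖ ^ q) / 2` whenever
`‖v - w‖ ≥ ε / 4 * max ‖v‖ ‖w‖` in a space with `δ(ε / 5) ≥ t`. The first term of the minimum serves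
vectors of nearly equal norms, the second one the others. -/
noncomputable def convexityGain (q ε : ℝ) : ℝ := min (1 / 2) (1 - powerMeanRatio q (1 - ε / 20))

section Gain

variable {q ε : ℝ}

theorem convexityGain_pos (hq : 1 < q) (hε : ε ∈ Ioc (0 : ℝ) 2) : 0 < convexityGain q ε :=
  lt_min (by norm_num)
    (sub_pos.2 (powerMeanRatio_lt_one hq (by linarith [hε.2]) (by linarith [hε.1])))

theorem convexityGain_le_half : convexityGain q ε ≤ 1 / 2 := min_le_left _ _

theorem convexityGain_monotoneOn (hq : 1 < q) : MonotoneOn (convexityGain q) (Ioc 0 2) := by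
  intro a ha b hb hab
  refine min_le_min le_rfl (sub_le_sub_left (powerMeanRatio_monotoneOn hq ?_ ?_ ?_) _)
  · exact ⟨by linarith [hb.2], by linarith [hb.1]⟩
  · exact ⟨by linarith [ha.2], by linarith [ha.1]⟩
  · linarith

theorem convexityGain_continuousOn : ContinuousOn (convexityGain q) (Ioc 0 2) := by
  unfold convexityGain powerMeanRatio
  refine ContinuousOn.inf continuousOn_const
    (continuousOn_const.sub (ContinuousOn.div ?_ ?_ ?_))
  · refine ContinuousOn.rpow_const (by fun_prop) fun ε hε => Or.inl ?_
    have := hε.2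
    have : (0 : ℝ) < (1 + (1 - ε / 20)) / 2 := by linarith
    exact this.ne'
  · refine (continuousOn_const.add ?_).div_const _
    refine ContinuousOn.rpow_const (by fun_prop) fun ε hε => Or.inl ?_
    have := hε.2
    have : (0 : ℝ) < 1 - ε / 20 := by linarith
    exact this.ne'
  · intro ε hε
    have := hε.2
    have : (0 : ℝ) < 1 - ε / 20 := by linarith
    positivity

/-- The factor `m(ε)` for which `φ(ε, t) = t * m(ε)` bounds the modulus of convexity of `Γ_q` from
below in terms of the lower bound `t` for the moduli of the fibers at `ε / 5`. -/
noncomputable def convexityRate (q ε : ℝ) : ℝ := convexityGain q ε * (ε / 2) ^ q / (2 * q)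

theorem convexityRate_pos (hq : 1 < q) (hε : ε ∈ Ioc (0 : ℝ) 2) : 0 < convexityRate q ε := by
  have h1 := convexityGain_pos hq hε
  have h2 : 0 < (ε / 2) ^ q := Real.rpow_pos_of_pos (half_pos hε.1) q
  unfold convexityRate
  positivity

theorem convexityRate_le_one (hq : 1 < q) (hε : ε ∈ Ioc (0 : ℝ) 2) : convexityRate q ε ≤ 1 := by
  have h1 := convexityGain_pos hq hε
  have h2 : (ε / 2) ^ q ≤ 1 :=
    Real.rpow_le_one (half_pos hε.1).le (by linarith [hε.2]) (by linarith)
  rw [convexityRate, div_le_one (by linarith)]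
  nlinarith [convexityGain_le_half (q := q) (ε := ε)]

theorem convexityRate_monotoneOn (hq : 1 < q) : MonotoneOn (convexityRate q) (Ioc 0 2) := by
  intro a ha b hb hab
  have h1 := convexityGain_monotoneOn hq ha hb hab
  have h2 := (convexityGain_pos hq hb).le
  have h3 := (half_pos ha.1).le
  unfold convexityRate
  gcongr

theorem convexityRate_continuousOn (hq : 1 < q) : ContinuousOn (convexityRate q) (Ioc 0 2) := by
  refine (convexityGain_continuousOn.mul ?_).div_const _
  exact ContinuousOn.rpow_const (by fun_prop) fun ε _ => Or.inr (by linarith)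

variable {V : Type*} [SeminormedAddCommGroup V] [NormedSpace ℝ V] {t : ℝ}

/-- Two vectors of comparable norms `‖w‖ ≤ ‖v‖` are far apart on the unit sphere after
normalization, so that the modulus of convexity bounds the norm of their midpoint. -/
theorem norm_midpoint_le_of_norm_sub_le (hε : ε ∈ Ioc (0 : ℝ) 2) (ht0 : 0 ≤ t)
    (ht : t ≤ modulusOfConvexity V (ε / 5)) {v w : V} (hv : 0 < ‖v‖)
    (hwv : ‖w‖ ≤ ‖v‖) (hclose : ‖v‖ - ‖w‖ ≤ ε / 20 * ‖v‖) (hfar : ε / 4 * ‖v‖ ≤ ‖v - w‖) :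
    ‖(2⁻¹ : ℝ) • (v + w)‖ ≤ (1 - t / 2) * ((‖v‖ + ‖w‖) / 2) := by
  obtain ⟨hε0, hε2⟩ := hε
  have hw : 0 < ‖w‖ := by nlinarith
  set a := ‖v‖ with ha
  set b := ‖w‖ with hb
  have hv1 : ‖a⁻¹ • v‖ = 1 := by
    rw [norm_smul, Real.norm_of_nonneg (by positivity), ← ha, inv_mul_cancel₀ hv.ne']
  have hw1 : ‖b⁻¹ • w‖ = 1 := by
    rw [norm_smul, Real.norm_of_nonneg (by positivity), ← hb, inv_mul_cancel₀ hw.ne']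
  have hd : ε / 5 ≤ ‖a⁻¹ • v - b⁻¹ • w‖ := by
    have e : v - w = a • (a⁻¹ • v - b⁻¹ • w) + (a - b) • (b⁻¹ • w) := by
      rw [smul_sub, smul_inv_smul₀ hv.ne', sub_smul, smul_inv_smul₀ hw.ne']; abel
    have h := norm_add_le (a • (a⁻¹ • v - b⁻¹ • w)) ((a - b) • (b⁻¹ • w))
    rw [← e, norm_smul a, norm_smul (a - b), hw1, Real.norm_of_nonneg hv.le,
      Real.norm_of_nonneg (sub_nonneg.2 hwv)] at h
    have : ε / 5 * a ≤ a * ‖a⁻¹ • v - b⁻¹ • w‖ := by linarith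
    nlinarith
  have hmid := (le_modulusOfConvexity_iff.1 ht).2 _ _ hv1 hw1 hd
  have e : (2⁻¹ : ℝ) • (v + w) =
      b • ((2⁻¹ : ℝ) • (a⁻¹ • v + b⁻¹ • w)) + ((a - b) / 2) • (a⁻¹ • v) := by
    simp only [smul_add, smul_smul, add_assoc]
    rw [add_comm ((b * (2⁻¹ * b⁻¹)) • w), ← add_assoc, ← add_smul]
    congr 2 <;> field_simp
    ring
  have h := norm_add_le (b • ((2⁻¹ : ℝ) • (a⁻¹ • v + b⁻¹ • w))) (((a - b) / 2) • (a⁻¹ • v))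
  rw [← e, norm_smul b, norm_smul ((a - b) / 2), hv1, Real.norm_of_nonneg hw.le,
    Real.norm_of_nonneg (by linarith)] at h
  have h3 : a ≤ 3 * b := by nlinarith
  nlinarith

theorem norm_midpoint_rpow_le_of_norm_le (hq : 1 < q) (hε : ε ∈ Ioc (0 : ℝ) 2) (ht0 : 0 ≤ t)
    (ht : t ≤ modulusOfConvexity V (ε / 5)) {v w : V} (hwv : ‖w‖ ≤ ‖v‖)
    (hfar : ε / 4 * ‖v‖ ≤ ‖v - w‖) :
    ‖(2⁻¹ : ℝ) • (v + w)‖ ^ q ≤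
      (1 - t * convexityGain q ε) * ((‖v‖ ^ q + ‖w‖ ^ q) / 2) := by
  have ht1 : t ≤ 1 := ht.trans modulusOfConvexity_le_one
  have hS : 0 ≤ (‖v‖ ^ q + ‖w‖ ^ q) / 2 := by positivity
  have hconv := half_add_rpow_le hq (norm_nonneg v) (norm_nonneg w)
  have htri : ‖(2⁻¹ : ℝ) • (v + w)‖ ≤ (‖v‖ + ‖w‖) / 2 := by
    rw [norm_smul, Real.norm_of_nonneg (by norm_num)]
    linarith [norm_add_le v w]
  rcases (norm_nonneg v).eq_or_lt with hv | hv
  · have hw : ‖w‖ = 0 := le_antisymm (hwv.trans hv.ge) (norm_nonneg w)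
    have h0 : ‖(2⁻¹ : ℝ) • (v + w)‖ = 0 :=
      le_antisymm (htri.trans (by rw [← hv, hw]; norm_num)) (norm_nonneg _)
    rw [h0, ← hv, hw, Real.zero_rpow (by linarith)]
    simp
  by_cases hclose : ‖v‖ - ‖w‖ ≤ ε / 20 * ‖v‖
  · have h := norm_midpoint_le_of_norm_sub_le hε ht0 ht hv hwv hclose hfar
    calc ‖(2⁻¹ : ℝ) • (v + w)‖ ^ q ≤ ((1 - t / 2) * ((‖v‖ + ‖w‖) / 2)) ^ q := by gcongr
      _ = (1 - t / 2) ^ q * ((‖v‖ + ‖w‖) / 2) ^ q :=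
          Real.mul_rpow (by linarith) (by positivity)
      _ ≤ (1 - t / 2) * ((‖v‖ ^ q + ‖w‖ ^ q) / 2) := by
          gcongr
          · linarith
          · exact (Real.rpow_le_rpow_of_exponent_ge (by linarith) (by linarith) hq.le).trans_eq
              (Real.rpow_one _)
      _ ≤ _ := by
          gcongr
          nlinarith [convexityGain_le_half (q := q) (ε := ε)]
  · have hr : 1 - ε / 20 ∈ Icc (0 : ℝ) 1 := ⟨by linarith [hε.2], by linarith [hε.1]⟩
    have h := half_add_rpow_le_powerMeanRatio hq hv (norm_nonneg w) hr (by linarith)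
    calc ‖(2⁻¹ : ℝ) • (v + w)‖ ^ q ≤ ((‖v‖ + ‖w‖) / 2) ^ q := by gcongr
      _ ≤ powerMeanRatio q (1 - ε / 20) * ((‖v‖ ^ q + ‖w‖ ^ q) / 2) := h
      _ ≤ _ := by
          gcongr
          have h1 : convexityGain q ε ≤ 1 - powerMeanRatio q (1 - ε / 20) := min_le_right _ _
          nlinarith [convexityGain_pos hq hε]

/-- The pointwise inequality behind uniform convexity of `Γ_p`. Unlike the gain inequality for
vectors that are far apart it holds for all pairs, because the bracket is negative for pairs that
are close; and for unit vectors of `L^q` at distance at least `ε` the integral of the bracket is at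
least `ε ^ q / 2`. -/
theorem norm_midpoint_rpow_add_le (hq : 1 < q) (hε : ε ∈ Ioc (0 : ℝ) 2) (ht0 : 0 ≤ t)
    (ht : t ≤ modulusOfConvexity V (ε / 5)) (v w : V) :
    ‖(2⁻¹ : ℝ) • (v + w)‖ ^ q + t * convexityGain q ε * (2⁻¹ : ℝ) ^ q *
        (‖v - w‖ ^ q - ε ^ q / 4 * (‖v‖ ^ q + ‖w‖ ^ q)) ≤
      (‖v‖ ^ q + ‖w‖ ^ q) / 2 := by
  wlog hwv : ‖w‖ ≤ ‖v‖ generalizing v w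
  · have h := this w v (le_of_not_ge hwv)
    rwa [add_comm w v, norm_sub_rev, add_comm (‖w‖ ^ q)] at h
  have hγ : 0 ≤ t * convexityGain q ε := mul_nonneg ht0 (convexityGain_pos hq hε).le
  have h2q : (0 : ℝ) < (2⁻¹ : ℝ) ^ q := by positivity
  have hconv := half_add_rpow_le hq (norm_nonneg v) (norm_nonneg w)
  have hε0 := hε.1
  by_cases hfar : ε ^ q / 4 * (‖v‖ ^ q + ‖w‖ ^ q) ≤ ‖v - w‖ ^ q
  · have hfar' : ε / 4 * ‖v‖ ≤ ‖v - w‖ := by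
      refine (Real.rpow_le_rpow_iff (by positivity) (norm_nonneg _) (by linarith : 0 < q)).1 ?_
      refine le_trans ?_ hfar
      rw [Real.mul_rpow (by positivity) (by positivity), Real.div_rpow hε0.le (by norm_num)]
      have h4 : (4 : ℝ) ≤ 4 ^ q := Real.self_le_rpow_of_one_le (by norm_num) hq.le
      gcongr
      linarith [Real.rpow_nonneg (norm_nonneg w) q]
    have h := norm_midpoint_rpow_le_of_norm_le hq hε ht0 ht hwv hfar'
    have hsub : (2⁻¹ : ℝ) ^ q * ‖v - w‖ ^ q ≤ (‖v‖ ^ q + ‖w‖ ^ q) / 2 := by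
      rw [← Real.mul_rpow (by norm_num) (norm_nonneg _)]
      refine le_trans ?_ hconv
      gcongr
      linarith [norm_sub_le v w]
    have hpos : 0 ≤ (2⁻¹ : ℝ) ^ q * (ε ^ q / 4 * (‖v‖ ^ q + ‖w‖ ^ q)) := by positivity
    nlinarith [mul_le_mul_of_nonneg_left
      (show (2⁻¹ : ℝ) ^ q * ‖v - w‖ ^ q - (2⁻¹ : ℝ) ^ q * (ε ^ q / 4 * (‖v‖ ^ q + ‖w‖ ^ q)) ≤
        (‖v‖ ^ q + ‖w‖ ^ q) / 2 by linarith) hγ]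
  · have h1 : ‖(2⁻¹ : ℝ) • (v + w)‖ ^ q ≤ ((‖v‖ + ‖w‖) / 2) ^ q := by
      gcongr
      rw [norm_smul, Real.norm_of_nonneg (by norm_num)]
      linarith [norm_add_le v w]
    have h2 : t * convexityGain q ε * (2⁻¹ : ℝ) ^ q *
        (‖v - w‖ ^ q - ε ^ q / 4 * (‖v‖ ^ q + ‖w‖ ^ q)) ≤ 0 :=
      mul_nonpos_of_nonneg_of_nonpos (by positivity) (by linarith)
    linarith

end Gain

/-! ### Measurable branches of Souslin schemes -/

section Souslin

variable {X : Type*}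

/-- The points `x` that admit a chain of `j` edges starting from the state `a` at level `k`, where
`C k a b` is the set of points for which `(a, b)` is an edge from level `k` to level `k + 1`, and
the states at level `i` that the chain reaches are bounded by `N i`. -/
def boundedChainSet (C : ℕ → ℕ → ℕ → Set X) (N : ℕ → ℕ) : ℕ → ℕ → ℕ → Set X
  | 0, _, _ => univ
  | j + 1, k, a => ⋃ b ∈ Iic (N (k + 1)), C k a b ∩ boundedChainSet C N j (k + 1) b

variable {C : ℕ → ℕ → ℕ → Set X} {N : ℕ → ℕ}

theorem boundedChainSet_succ_subset (j : ℕ) :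
    ∀ k a, boundedChainSet C N (j + 1) k a ⊆ boundedChainSet C N j k a := by
  induction j with
  | zero => exact fun _ _ => subset_univ _
  | succ j ih =>
    exact fun k a => iUnion₂_mono fun b _ => inter_subset_inter_right _ (ih _ b)

theorem boundedChainSet_antitone (k a : ℕ) : Antitone fun j => boundedChainSet C N j k a :=
  antitone_nat_of_succ_le fun j => boundedChainSet_succ_subset j k a

theorem mem_boundedChainSet_of_path {x : X} {σ : ℕ → ℕ} (hσ : ∀ k, x ∈ C k (σ k) (σ (k + 1)))
    (j : ℕ) : ∀ k, (∀ i ≤ k + j, σ i ≤ N i) → x ∈ boundedChainSet C N j k (σ k) := by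
  induction j with
  | zero => exact fun _ _ => mem_univ _
  | succ j ih =>
    exact fun k h => mem_iUnion₂.2 ⟨σ (k + 1), h _ (by omega), hσ k, ih _ fun i hi => h i (by omega)⟩

/-- König's lemma: chains of all finite lengths through boundedly many states can be continued. -/
theorem exists_mem_iInter_boundedChainSet {x : X} {k a : ℕ}
    (hx : x ∈ ⋂ j, boundedChainSet C N j k a) :
    ∃ b, x ∈ C k a b ∩ ⋂ j, boundedChainSet C N j (k + 1) b := by
  by_contra! hc
  have h : ∀ b, x ∈ C k a b → ∃ j, x ∉ boundedChainSet C N j (k + 1) b := by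
    intro b hb
    by_contra! h
    exact hc b ⟨hb, mem_iInter.2 h⟩
  choose! J hJ using h
  obtain ⟨b, hbN, hb, hbJ⟩ := mem_iUnion₂.1
    (mem_iInter.1 hx ((Finset.range (N (k + 1) + 1)).sup J + 1))
  refine hJ b hb (boundedChainSet_antitone _ _ (Finset.le_sup (f := J) ?_) hbJ)
  exact Finset.mem_range.2 (Nat.lt_succ_of_le hbN)

variable [MeasurableSpace X] {μ : Measure X}

theorem measurableSet_boundedChainSet (hC : ∀ k a b, MeasurableSet (C k a b)) (j : ℕ) :
    ∀ k a, MeasurableSet (boundedChainSet C N j k a) := by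
  induction j with
  | zero => exact fun _ _ => MeasurableSet.univ
  | succ j ih =>
    exact fun k a => MeasurableSet.biUnion (to_countable _) fun b _ => (hC k a b).inter (ih _ b)

/-- Capacitability: continuity from below of the outer measure gives bounds `N` that retain a set of
positive measure. The sets of branches bounded up to level `k` need not have a measurable set of
base points, but the sets `boundedChainSet` that contain them are measurable and decreasing. -/
theorem exists_bound_measure_ne_zero [IsFiniteMeasure μ] (hC : ∀ k a b, MeasurableSet (C k a b))
    (h : μ {x | ∃ σ : ℕ → ℕ, ∀ k, x ∈ C k (σ k) (σ (k + 1))} ≠ 0) :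
    ∃ (N : ℕ → ℕ) (a : ℕ), μ (⋂ j, boundedChainSet C N j 0 a) ≠ 0 := by
  let base : Set (ℕ → ℕ) → Set X := fun T => {x | ∃ σ ∈ T, ∀ k, x ∈ C k (σ k) (σ (k + 1))}
  obtain ⟨a, ha⟩ : ∃ a : ℕ, μ (base {σ | σ 0 = a}) ≠ 0 := by
    by_contra! hc
    refine h (measure_mono_null ?_ (measure_iUnion_null hc))
    rintro x ⟨σ, hσ⟩
    exact mem_iUnion.2 ⟨σ 0, σ, rfl, hσ⟩
  obtain ⟨c, hc0, hc⟩ := exists_between (pos_iff_ne_zero.2 ha)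
  have step : ∀ (k : ℕ) (T : {T // c < μ (base T)}), ∃ m, c < μ (base (T.1 ∩ {σ | σ k ≤ m})) := by
    rintro k ⟨T, hT⟩
    have hU : base T = ⋃ m : ℕ, base (T ∩ {σ | σ k ≤ m}) := by
      ext x
      constructor
      · rintro ⟨σ, hσT, hσ⟩
        exact mem_iUnion.2 ⟨σ k, σ, ⟨hσT, le_refl (σ k)⟩, hσ⟩
      · intro hx
        obtain ⟨m, σ, hσT, hσ⟩ := mem_iUnion.1 hx
        exact ⟨σ, hσT.1, hσ⟩
    have hmono : Monotone fun m : ℕ => base (T ∩ {σ | σ k ≤ m}) := by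
      rintro m n hmn x ⟨σ, hσT, hσ⟩
      exact ⟨σ, ⟨hσT.1, le_trans hσT.2 hmn⟩, hσ⟩
    rw [hU, hmono.measure_iUnion] at hT
    exact lt_iSup_iff.1 hT
  choose m hm using step
  let T : ℕ → {T // c < μ (base T)} := fun k =>
    Nat.rec ⟨{σ | σ 0 = a}, hc⟩ (fun k T => ⟨T.1 ∩ {σ | σ k ≤ m k T}, hm k T⟩) k
  let N : ℕ → ℕ := fun k => m k (T k)
  have hT : ∀ k, ∀ σ ∈ (T k).1, σ 0 = a ∧ ∀ i < k, σ i ≤ N i := by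
    intro k
    induction k with
    | zero => exact fun σ hσ => ⟨hσ, fun i hi => absurd hi (Nat.not_lt_zero i)⟩
    | succ k ih =>
      rintro σ ⟨hσ, hσk⟩
      refine ⟨(ih σ hσ).1, fun i hi => ?_⟩
      rcases (Nat.lt_succ_iff_lt_or_eq.1 hi) with hi | rfl
      · exact (ih σ hσ).2 i hi
      · exact hσk
  refine ⟨N, a, (hc0.trans_le ?_).ne'⟩
  refine ge_of_tendsto' (tendsto_measure_iInter_atTop
    (fun j => (measurableSet_boundedChainSet hC j 0 a).nullMeasurableSet)
    (boundedChainSet_antitone 0 a) ⟨0, measure_ne_top _ _⟩) fun j => ?_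
  refine (T (j + 1)).2.le.trans (measure_mono ?_)
  rintro x ⟨σ, hσT, hσ⟩
  obtain ⟨rfl, hb⟩ := hT (j + 1) σ hσT
  exact mem_boundedChainSet_of_path hσ j 0 fun i hi => hb i (by omega)

/-- A Souslin scheme of measurable sets has, over some measurable set of positive measure, a branch
that depends measurably on the point: always continue with the least state that has an infinite
continuation. -/
theorem exists_measurable_branch [IsFiniteMeasure μ] (hC : ∀ k a b, MeasurableSet (C k a b))
    (h : μ {x | ∃ σ : ℕ → ℕ, ∀ k, x ∈ C k (σ k) (σ (k + 1))} ≠ 0) :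
    ∃ D, MeasurableSet D ∧ μ D ≠ 0 ∧ ∃ τ : ℕ → X → ℕ, (∀ k, Measurable (τ k)) ∧
      ∀ x ∈ D, ∀ k, x ∈ C k (τ k x) (τ (k + 1) x) := by
  classical
  obtain ⟨N, a₀, hN⟩ := exists_bound_measure_ne_zero hC h
  let R : ℕ → ℕ → Set X := fun k a => ⋂ j, boundedChainSet C N j k a
  have hR : ∀ k a, MeasurableSet (R k a) := fun k a =>
    MeasurableSet.iInter fun j => measurableSet_boundedChainSet hC j k a
  let S : ℕ → ℕ → ℕ → Set X := fun k a b => C k a b ∩ R (k + 1) b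
  have hS : ∀ k a b, MeasurableSet (S k a b) := fun k a b => (hC k a b).inter (hR _ _)
  -- The second alternative makes the search for a continuation succeed at every point.
  have hex : ∀ (k : ℕ) (a : ℕ) (x : X), ∃ b, x ∈ S k a b ∨ ∀ c, x ∉ S k a c := by
    intro k a x
    by_cases hx : ∃ b, x ∈ S k a b
    · exact ⟨hx.choose, Or.inl hx.choose_spec⟩
    · exact ⟨0, Or.inr (not_exists.1 hx)⟩
  let next : ℕ → ℕ → X → ℕ := fun k a x => Nat.find (hex k a x)
  have hnext : ∀ k a, Measurable (next k a) := by
    intro k a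
    refine measurable_find (hex k a) fun b => ?_
    have hnone : MeasurableSet {x | ∀ c, x ∉ S k a c} := by
      convert MeasurableSet.iInter fun c => (hS k a c).compl using 1
      ext x
      simp
    exact (hS k a b).union hnone
  let τ : ℕ → X → ℕ := fun k x => Nat.rec a₀ (fun k a => next k a x) k
  refine ⟨R 0 a₀, hR _ _, hN, τ, fun k => ?_, fun x hx => ?_⟩
  · induction k with
    | zero => exact measurable_const
    | succ k ih =>
      have : Measurable fun z : ℕ × X => next k z.1 z.2 :=
        measurable_from_prod_countable_right fun a => hnext k a
      exact this.comp (ih.prodMk measurable_id)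
  · have key : ∀ k, x ∈ R k (τ k x) → x ∈ S k (τ k x) (τ (k + 1) x) := by
      intro k hk
      obtain ⟨b, hb⟩ := exists_mem_iInter_boundedChainSet hk
      exact (Nat.find_spec (hex k (τ k x) x)).resolve_right fun h => h b hb
    have hRk : ∀ k, x ∈ R k (τ k x) := by
      intro k
      induction k with
      | zero => exact hx
      | succ k ih => exact (key k ih).2
    exact fun k => (key k (hRk k)).1

end Souslin

/-! ### Measurable selection on a set of positive measure -/

section Selection

variable {X : Type*} [MeasurableSpace X] {μ : Measure X}

/-- If a weakly measurable closed-valued map `G` meets a closed set `F` over a set of points that is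
not null (a set that is analytic in general, and need not be measurable), then it has a measurable
selection in `F` over a measurable set of positive measure. -/
theorem exists_stronglyMeasurable_selection [SFinite μ] {W : Type*} [MetricSpace W]
    [CompleteSpace W] [SeparableSpace W] {G : X → Set W} {F : Set W} (hGc : ∀ x, IsClosed (G x))
    (hG : ∀ z r, MeasurableSet {x | (G x ∩ Metric.ball z r).Nonempty}) (hF : IsClosed F)
    (h : μ {x | (G x ∩ F).Nonempty} ≠ 0) :
    ∃ D, MeasurableSet D ∧ μ D ≠ 0 ∧ ∃ s : X → W, StronglyMeasurable s ∧
      ∀ x ∈ D, s x ∈ G x ∩ F := by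
  classical
  obtain ⟨x₀, z₀, -⟩ := nonempty_of_measure_ne_zero h
  have : Nonempty W := ⟨z₀⟩
  let e := denseSeq W
  let C : ℕ → ℕ → ℕ → Set X := fun k a b =>
    {x | (G x ∩ Metric.ball (e a) ((1 / 2) ^ k)).Nonempty} ∩
      {_x | (F ∩ Metric.ball (e a) ((1 / 2) ^ k)).Nonempty ∧ dist (e a) (e b) ≤ 2 * (1 / 2) ^ k}
  have hC : ∀ k a b, MeasurableSet (C k a b) := fun k a b =>
    (hG _ _).inter (MeasurableSet.const _)
  have hbranch : {x | (G x ∩ F).Nonempty} ⊆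
      {x | ∃ σ : ℕ → ℕ, ∀ k, x ∈ C k (σ k) (σ (k + 1))} := by
    rintro x ⟨z, hzG, hzF⟩
    have hd : ∀ k : ℕ, ∃ a, dist z (e a) < (1 / 2) ^ k := fun k =>
      (denseRange_denseSeq W).exists_dist_lt z (by positivity)
    choose σ hσ using hd
    refine ⟨σ, fun k => ⟨⟨z, hzG, hσ k⟩, ⟨z, hzF, hσ k⟩, ?_⟩⟩
    have h1 := dist_triangle_left (e (σ k)) (e (σ (k + 1))) z
    have h2 : ((1 : ℝ) / 2) ^ (k + 1) ≤ (1 / 2) ^ k :=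
      pow_le_pow_of_le_one (by norm_num) (by norm_num) (Nat.le_succ k)
    linarith [hσ k, hσ (k + 1)]
  obtain ⟨D, hD, hD0, τ, hτ, hτC⟩ := exists_measurable_branch (μ := μ.toFinite) hC
    fun h0 => h (absolutelyContinuous_toFinite μ (measure_mono_null hbranch h0))
  let u : ℕ → X → W := fun k x => if x ∈ D then e (τ k x) else z₀
  have hu : ∀ k, StronglyMeasurable (u k) := fun k =>
    StronglyMeasurable.ite hD (StronglyMeasurable.of_discrete.comp_measurable (hτ k))
      stronglyMeasurable_const
  have hlim : ∀ x, ∃ z, Tendsto (fun k => u k x) atTop (𝓝 z) := by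
    intro x
    by_cases hx : x ∈ D
    · refine cauchySeq_tendsto_of_complete (cauchySeq_of_le_geometric (1 / 2) 2 (by norm_num) ?_)
      intro k
      simpa only [u, if_pos hx] using (hτC x hx k).2.2
    · exact ⟨z₀, by simp only [u, if_neg hx]; exact tendsto_const_nhds⟩
  choose s hs using hlim
  refine ⟨D, hD, fun h0 => hD0 (toFinite_absolutelyContinuous μ h0), s,
    stronglyMeasurable_of_tendsto atTop hu (tendsto_pi_nhds.2 hs), fun x hx => ?_⟩
  have hmem : ∀ H : Set W, IsClosed H →
      (∀ k, (H ∩ Metric.ball (e (τ k x)) ((1 / 2) ^ k)).Nonempty) → s x ∈ H := by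
    intro H hH hk
    choose y hyH hy using hk
    refine hH.mem_of_tendsto (f := y) (b := atTop) ?_ (Eventually.of_forall hyH)
    refine (hs x).congr_dist ?_
    refine squeeze_zero (fun k => dist_nonneg) (fun k => ?_)
      (tendsto_pow_atTop_nhds_zero_of_lt_one (r := (1 / 2 : ℝ)) (by norm_num) (by norm_num))
    simp only [u, if_pos hx]
    rw [dist_comm]
    exact (Metric.mem_ball.1 (hy k)).le
  exact ⟨hmem _ (hGc x) fun k => (hτC x hx k).1, hmem _ hF fun k => (hτC x hx k).2.1⟩

end Selection

/-! ### Comparison of the section space with its fibers -/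

section LpNorm

variable {X : Type*} [MeasurableSpace X] {μ : Measure X} {B : Type*} [NormedAddCommGroup B]
  {p : ℝ≥0∞}

theorem ENNReal.one_lt_toReal (hp1 : 1 < p) (hp : p ≠ ∞) : 1 < p.toReal := by
  rw [← ENNReal.toReal_one]
  exact (ENNReal.toReal_lt_toReal ENNReal.one_ne_top hp).2 hp1

theorem MeasureTheory.Lp.norm_rpow_eq_integral (hp1 : 1 < p) (hp : p ≠ ∞) (f : Lp B p μ) :
    ‖f‖ ^ p.toReal = ∫ x, ‖f x‖ ^ p.toReal ∂μ := by
  have hp0 : p ≠ 0 := (zero_lt_one.trans hp1).ne'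
  have hI : 0 ≤ ∫ x, ‖f x‖ ^ p.toReal ∂μ := integral_nonneg fun x => by positivity
  rw [Lp.norm_def, (Lp.memLp f).eLpNorm_eq_integral_rpow_norm hp0 hp,
    ENNReal.toReal_ofReal (by positivity), Real.rpow_inv_rpow hI (ENNReal.toReal_pos hp0 hp).ne']

theorem MeasureTheory.Lp.integrable_norm_rpow (hp1 : 1 < p) (hp : p ≠ ∞) (f : Lp B p μ) :
    Integrable (fun x => ‖f x‖ ^ p.toReal) μ :=
  (Lp.memLp f).integrable_norm_rpow (zero_lt_one.trans hp1).ne' hp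

end LpNorm

namespace BanachBundle

variable {X : Type*} [MeasurableSpace X] {μ : Measure X} {B : Type*} [NormedAddCommGroup B]
  [NormedSpace ℝ B] {E : BanachBundle X B} {p : ℝ≥0∞} [Fact (1 ≤ p)] {ε t : ℝ}

/-- A lower bound `t` for the moduli of convexity of almost all fibers at `ε / 5` passes to the
section space, by integration of the pointwise inequality. -/
theorem mul_convexityRate_le_modulusOfConvexity (hp1 : 1 < p) (hp : p ≠ ∞)
    (hε : ε ∈ Ioc (0 : ℝ) 2) (ht0 : 0 ≤ t) (ht1 : t ≤ 1)
    (ht : ∀ᵐ x ∂μ, t ≤ modulusOfConvexity (E.fiber x) (ε / 5)) :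
    t * convexityRate p.toReal ε ≤ modulusOfConvexity (E.sectionSpace p μ) ε := by
  set q := p.toReal with hq_def
  have hq : 1 < q := ENNReal.one_lt_toReal hp1 hp
  have hm0 := convexityRate_pos hq hε
  have hm1 := convexityRate_le_one hq hε
  refine le_modulusOfConvexity_iff.2 ⟨by nlinarith, ?_⟩
  rintro ⟨f, hf⟩ ⟨g, hg⟩ hf1 hg1 hfg
  change ‖f‖ = 1 at hf1
  change ‖g‖ = 1 at hg1
  change ε ≤ ‖f - g‖ at hfg
  change t * convexityRate q ε ≤ 1 - ‖(2⁻¹ : ℝ) • (f + g)‖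
  have hpt : ∀ᵐ x ∂μ, ‖((2⁻¹ : ℝ) • (f + g) : Lp B p μ) x‖ ^ q +
      t * convexityGain q ε * (2⁻¹ : ℝ) ^ q *
        (‖(f - g : Lp B p μ) x‖ ^ q - ε ^ q / 4 * (‖f x‖ ^ q + ‖g x‖ ^ q)) ≤
      (‖f x‖ ^ q + ‖g x‖ ^ q) / 2 := by
    filter_upwards [ht, (E.mem_sectionSpace_iff f).1 hf, (E.mem_sectionSpace_iff g).1 hg,
      Lp.coeFn_smul (2⁻¹ : ℝ) (f + g), Lp.coeFn_add f g, Lp.coeFn_sub f g]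
      with x hx hfx hgx h1 h2 h3
    have h := norm_midpoint_rpow_add_le hq hε ht0 hx ⟨f x, hfx⟩ ⟨g x, hgx⟩
    rw [h1, h3, Pi.smul_apply, h2]
    exact h
  have hif := Lp.integrable_norm_rpow hp1 hp f
  have hig := Lp.integrable_norm_rpow hp1 hp g
  have him := Lp.integrable_norm_rpow hp1 hp ((2⁻¹ : ℝ) • (f + g))
  have hid := Lp.integrable_norm_rpow hp1 hp (f - g)
  have hsum : Integrable (fun x => ‖f x‖ ^ q + ‖g x‖ ^ q) μ := hif.add hig
  have hdiff : Integrable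
      (fun x => ‖(f - g : Lp B p μ) x‖ ^ q - ε ^ q / 4 * (‖f x‖ ^ q + ‖g x‖ ^ q)) μ :=
    hid.sub (hsum.const_mul _)
  have hint := integral_mono_ae (him.add (hdiff.const_mul _)) (hsum.div_const 2) hpt
  simp only [Pi.add_apply] at hint
  rw [integral_add him (hdiff.const_mul _), integral_const_mul,
    integral_sub hid (hsum.const_mul _), integral_const_mul, integral_div, integral_add hif hig,
    ← Lp.norm_rpow_eq_integral hp1 hp f, ← Lp.norm_rpow_eq_integral hp1 hp g,
    ← Lp.norm_rpow_eq_integral hp1 hp (f - g),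
    ← Lp.norm_rpow_eq_integral hp1 hp ((2⁻¹ : ℝ) • (f + g)), hf1, hg1, Real.one_rpow,
    ← hq_def] at hint
  have hε0 := hε.1
  have hd : ε ^ q ≤ ‖f - g‖ ^ q := by gcongr
  have hK : 0 ≤ t * convexityGain q ε * (2⁻¹ : ℝ) ^ q := by
    have := convexityGain_pos hq hε
    positivity
  have hKε : t * convexityGain q ε * (2⁻¹ : ℝ) ^ q * (ε ^ q / 2) = q * (t * convexityRate q ε) := by
    rw [convexityRate, div_eq_mul_inv ε 2, Real.mul_rpow hε0.le (by norm_num)]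
    field_simp
  have hN : ‖(2⁻¹ : ℝ) • (f + g)‖ ^ q ≤ 1 - q * (t * convexityRate q ε) := by
    nlinarith [mul_le_mul_of_nonneg_left hd hK]
  have hbern := one_add_mul_self_le_rpow_one_add
    (show -1 ≤ -(t * convexityRate q ε) by nlinarith) hq.le
  have := (Real.rpow_le_rpow_iff (norm_nonneg _) (by nlinarith) (by linarith : 0 < q)).1
    (show ‖(2⁻¹ : ℝ) • (f + g)‖ ^ q ≤ (1 + -(t * convexityRate q ε)) ^ q by linarith)
  linarith

/-- The inequality `δ_Γ(ε) ≤ δ_{E(x)}(ε)` for almost every `x`. If it fails on a set that is not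
null, a measurable selection of extremal pairs in the fibers over a set of finite positive measure
gives a pair of sections. The selection has to be exact, since `δ` need not be continuous at
`ε = 2`. -/
theorem ae_modulusOfConvexity_sectionSpace_le [SigmaFinite μ] [CompleteSpace B] [SeparableSpace B]
    (hp1 : 1 < p) (hp : p ≠ ∞) :
    ∀ᵐ x ∂μ, modulusOfConvexity (E.sectionSpace p μ) ε ≤ modulusOfConvexity (E.fiber x) ε := by
  suffices h : ∀ s < modulusOfConvexity (E.sectionSpace p μ) ε,
      ∀ᵐ x ∂μ, s ≤ modulusOfConvexity (E.fiber x) ε by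
    have hn : ∀ᵐ x ∂μ, ∀ n : ℕ, modulusOfConvexity (E.sectionSpace p μ) ε - 1 / (n + 1) ≤
        modulusOfConvexity (E.fiber x) ε :=
      ae_all_iff.2 fun n => h _ (sub_lt_self _ Nat.one_div_pos_of_nat)
    filter_upwards [hn] with x hx
    refine ge_of_tendsto' (f := fun n : ℕ => modulusOfConvexity (E.fiber x) ε + 1 / ((n : ℝ) + 1))
      (x := atTop) ?_ fun n => by linarith [hx n]
    simpa only [add_zero] using tendsto_const_nhds.add
      (tendsto_one_div_add_atTop_nhds_zero_nat (𝕜 := ℝ))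
  intro s hs
  by_contra hbad
  have hs1 : s ≤ 1 := hs.le.trans modulusOfConvexity_le_one
  let F : Set (B × B) := {z | ‖z.1‖ = 1 ∧ ‖z.2‖ = 1 ∧ ε ≤ ‖z.1 - z.2‖ ∧
    1 - s ≤ ‖(2⁻¹ : ℝ) • (z.1 + z.2)‖}
  have hF : IsClosed F := by
    have h1 : IsClosed {z : B × B | ‖z.1‖ = 1} := isClosed_eq (by fun_prop) (by fun_prop)
    have h2 : IsClosed {z : B × B | ‖z.2‖ = 1} := isClosed_eq (by fun_prop) (by fun_prop)
    have h3 : IsClosed {z : B × B | ε ≤ ‖z.1 - z.2‖} := isClosed_le (by fun_prop) (by fun_prop)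
    have h4 : IsClosed {z : B × B | 1 - s ≤ ‖(2⁻¹ : ℝ) • (z.1 + z.2)‖} :=
      isClosed_le (by fun_prop) (by fun_prop)
    exact h1.inter (h2.inter (h3.inter h4))
  obtain ⟨D, hD, hD0, z, hz, hzmem⟩ := exists_stronglyMeasurable_selection (μ := μ)
    (G := fun x => (E.fiber x : Set B) ×ˢ (E.fiber x : Set B)) (F := F)
    (fun x => (E.isClosed_fiber x).prod (E.isClosed_fiber x))
    (fun c r => by
      have : {x | ((E.fiber x : Set B) ×ˢ (E.fiber x : Set B) ∩ Metric.ball c r).Nonempty} =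
          {x | ((E.fiber x : Set B) ∩ Metric.ball c.1 r).Nonempty} ∩
            {x | ((E.fiber x : Set B) ∩ Metric.ball c.2 r).Nonempty} := by
        ext x
        rw [← Prod.mk.eta (p := c), ← ball_prod_same, mem_ofPred_eq, prod_inter_prod,
          prod_nonempty_iff]
        rfl
      rw [this]
      exact (E.weaklyMeasurable _ Metric.isOpen_ball).inter
        (E.weaklyMeasurable _ Metric.isOpen_ball))
    hF (fun h0 => hbad (ae_iff.2 (measure_mono_null (fun x hx => by
      obtain ⟨v, w, hv, hw, hvw, hm⟩ := exists_of_modulusOfConvexity_lt hs1 (not_le.1 hx)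
      exact ⟨(v, w), ⟨v.2, w.2⟩, hv, hw, hvw, hm⟩) h0)))
  obtain ⟨D', hD', hDD', hD'0, hD'top⟩ :=
    Measure.exists_subset_measure_lt_top hD (pos_iff_ne_zero.2 hD0)
  have hp0 : p ≠ 0 := (zero_lt_one.trans hp1).ne'
  set c : ℝ := (μ.real D' ^ (1 / p.toReal))⁻¹ with hc
  have hDreal : 0 < μ.real D' := ENNReal.toReal_pos hD'0.ne' hD'top.ne
  have hc0 : 0 < c := by positivity
  -- The norms of the sections below are compared with those of multiples of this scalar unit vector.
  set I : Lp ℝ p μ := indicatorConstLp p hD' hD'top.ne c with hI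
  have hI1 : ‖I‖ = 1 := by
    rw [hI, norm_indicatorConstLp hp0 hp, Real.norm_of_nonneg hc0.le, hc]
    exact inv_mul_cancel₀ (by positivity)
  have hIx : ∀ᵐ x ∂μ, I x = D'.indicator (fun _ => c) x := indicatorConstLp_coeFn
  have hsec : ∀ u : X → B, StronglyMeasurable u → (∀ x ∈ D', u x ∈ E.fiber x ∧ ‖u x‖ = 1) →
      ∃ f : Lp B p μ, f ∈ E.sectionSpace p μ ∧ ‖f‖ = 1 ∧
        ∀ᵐ x ∂μ, f x = D'.indicator (fun x => c • u x) x := by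
    intro u hu hux
    have hnorm : ∀ x, ‖D'.indicator (fun x => c • u x) x‖ = ‖D'.indicator (fun _ => c) x‖ := by
      intro x
      by_cases hx : x ∈ D'
      · simp [hx, norm_smul, (hux x hx).2]
      · simp [hx]
    have hmeas : StronglyMeasurable (D'.indicator fun x => c • u x) :=
      (hu.const_smul c).indicator hD'
    have hmem : MemLp (D'.indicator fun x => c • u x) p μ :=
      (memLp_indicator_const p hD' c (Or.inr hD'top.ne)).of_le hmeas.aestronglyMeasurable
        (Eventually.of_forall fun x => (hnorm x).le)
    refine ⟨hmem.toLp, ⟨_, ⟨hmeas, fun x => ?_⟩, hmem.coeFn_toLp⟩, ?_, hmem.coeFn_toLp⟩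
    · by_cases hx : x ∈ D'
      · simpa [hx] using (E.fiber x).smul_mem c (hux x hx).1
      · simp [hx]
    · rw [← hI1]
      apply le_antisymm <;> refine Lp.norm_le_norm_of_ae_le ?_ <;>
        filter_upwards [hIx, hmem.coeFn_toLp] with x h1 h2 <;> rw [h1, h2, hnorm]
  obtain ⟨f, hfE, hf1, hf⟩ := hsec (fun x => (z x).1) (continuous_fst.comp_stronglyMeasurable hz)
    fun x hx => ⟨(hzmem x (hDD' hx)).1.1, (hzmem x (hDD' hx)).2.1⟩
  obtain ⟨g, hgE, hg1, hg⟩ := hsec (fun x => (z x).2) (continuous_snd.comp_stronglyMeasurable hz)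
    fun x hx => ⟨(hzmem x (hDD' hx)).1.2, (hzmem x (hDD' hx)).2.2.1⟩
  have hge : ∀ (r : ℝ) (k : Lp B p μ),
      (∀ᵐ x ∂μ, x ∈ D' → r * c ≤ ‖k x‖) → r ≤ ‖k‖ := by
    intro r k hk
    rcases le_or_gt r 0 with hr | hr
    · exact hr.trans (norm_nonneg k)
    · have h : ‖r • I‖ ≤ ‖k‖ := by
        refine Lp.norm_le_norm_of_ae_le ?_
        filter_upwards [hk, hIx, Lp.coeFn_smul r I] with x h1 h2 h3
        rw [h3, Pi.smul_apply, h2, norm_smul, Real.norm_of_nonneg hr.le]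
        by_cases hx : x ∈ D'
        · simpa [hx, abs_of_pos hc0] using h1 hx
        · simp [hx]
      rwa [norm_smul, hI1, mul_one, Real.norm_of_nonneg hr.le] at h
  have hfg : ε ≤ ‖f - g‖ := by
    refine hge ε _ ?_
    filter_upwards [hf, hg, Lp.coeFn_sub f g] with x h1 h2 h3 hx
    rw [h3, Pi.sub_apply, h1, h2, indicator_of_mem hx, indicator_of_mem hx, ← smul_sub, norm_smul,
      Real.norm_of_nonneg hc0.le, mul_comm]
    exact mul_le_mul_of_nonneg_left (hzmem x (hDD' hx)).2.2.2.1 hc0.le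
  have hmid : 1 - s ≤ ‖(2⁻¹ : ℝ) • (f + g)‖ := by
    refine hge _ _ ?_
    filter_upwards [hf, hg, Lp.coeFn_add f g, Lp.coeFn_smul (2⁻¹ : ℝ) (f + g)] with x h1 h2 h3 h4 hx
    rw [h4, Pi.smul_apply, h3, Pi.add_apply, h1, h2, indicator_of_mem hx, indicator_of_mem hx,
      ← smul_add, smul_comm, norm_smul, Real.norm_of_nonneg hc0.le, mul_comm]
    exact mul_le_mul_of_nonneg_left (hzmem x (hDD' hx)).2.2.2.2 hc0.le
  have h := (le_modulusOfConvexity_iff.1 le_rfl).2 (⟨f, hfE⟩ : E.sectionSpace p μ) ⟨g, hgE⟩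
    hf1 hg1 hfg
  change _ ≤ 1 - ‖(2⁻¹ : ℝ) • (f + g)‖ at h
  linarith

theorem modulusOfConvexity_sectionSpace_le_essInfReal [SigmaFinite μ] [CompleteSpace B]
    [SeparableSpace B] (hp1 : 1 < p) (hp : p ≠ ∞) :
    (modulusOfConvexity (E.sectionSpace p μ) ε : EReal) ≤
      essInfReal μ fun x => modulusOfConvexity (E.fiber x) ε :=
  le_essInf_of_ae_le _ <| by
    filter_upwards [ae_modulusOfConvexity_sectionSpace_le (E := E) (ε := ε) hp1 hp] with x hx
    exact EReal.coe_le_coe_iff.2 hx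

theorem essInfReal_mul_convexityRate_le (hμ : μ ≠ 0) (hp1 : 1 < p) (hp : p ≠ ∞)
    (hε : ε ∈ Ioc (0 : ℝ) 2) :
    essInfReal μ (fun x => modulusOfConvexity (E.fiber x) (ε / 5) * convexityRate p.toReal ε) ≤
      (modulusOfConvexity (E.sectionSpace p μ) ε : EReal) := by
  have hq : 1 < p.toReal := ENNReal.one_lt_toReal hp1 hp
  have hm0 := convexityRate_pos hq hε
  have : (ae μ).NeBot := ae_neBot.2 hμ
  refine EReal.ge_of_forall_gt_iff_ge.1 fun c hc => ?_
  rw [EReal.coe_le_coe_iff]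
  have hae := ae_lt_of_lt_essInf hc
  rcases le_or_gt c 0 with hc0 | hc0
  · exact hc0.trans modulusOfConvexity_nonneg
  have ht : ∀ᵐ x ∂μ, c / convexityRate p.toReal ε ≤ modulusOfConvexity (E.fiber x) (ε / 5) := by
    filter_upwards [hae] with x hx
    exact (div_le_iff₀ hm0).2 (EReal.coe_lt_coe_iff.1 hx).le
  obtain ⟨x, hx⟩ := ht.exists
  have h := mul_convexityRate_le_modulusOfConvexity hp1 hp hε (by positivity)
    (hx.trans modulusOfConvexity_le_one) ht
  rwa [div_mul_cancel₀ _ hm0.ne'] at h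

theorem isUniformlyConvex_sectionSpace (hp1 : 1 < p) (hp : p ≠ ∞)
    (h : ∀ ε ∈ Ioc (0 : ℝ) 2,
      0 < essInfReal μ fun x => modulusOfConvexity (E.fiber x) ε) :
    IsUniformlyConvex (E.sectionSpace p μ) := by
  intro ε hε
  have hq : 1 < p.toReal := ENNReal.one_lt_toReal hp1 hp
  obtain ⟨t, ht0, ht⟩ := EReal.lt_iff_exists_real_btwn.1
    (h (ε / 5) ⟨by linarith [hε.1], by linarith [hε.2, hε.1]⟩)
  have ht0' : 0 < t := EReal.coe_pos.1 ht0
  refine lt_of_lt_of_le ?_ (mul_convexityRate_le_modulusOfConvexity (t := min t 1) hp1 hp hε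
    (le_min ht0'.le zero_le_one) (min_le_right _ _) ?_)
  · exact mul_pos (lt_min ht0' one_pos) (convexityRate_pos hq hε)
  · filter_upwards [ae_lt_of_lt_essInf ht] with x hx
    exact (min_le_left _ _).trans (EReal.coe_lt_coe_iff.1 hx).le

theorem isUniformlyConvexBundle_of_essInfReal_pos
    (h : ∀ ε ∈ Ioc (0 : ℝ) 2,
      0 < essInfReal μ fun x => modulusOfConvexity (E.fiber x) ε) :
    E.IsUniformlyConvexBundle μ := by
  have hn : ∀ᵐ x ∂μ, ∀ n : ℕ, 0 < modulusOfConvexity (E.fiber x) (1 / ((n : ℝ) + 1)) := by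
    refine ae_all_iff.2 fun n => ?_
    have h1 : (1 : ℝ) / (n + 1) ≤ 1 := by
      rw [div_le_one (by positivity)]
      linarith [Nat.cast_nonneg (α := ℝ) n]
    filter_upwards [ae_lt_of_lt_essInf (h _ ⟨Nat.one_div_pos_of_nat, h1.trans one_le_two⟩)]
      with x hx
    exact EReal.coe_pos.1 hx
  filter_upwards [hn] with x hx ε hε
  obtain ⟨n, hn⟩ := exists_nat_one_div_lt hε.1
  exact (hx n).trans_le (modulusOfConvexity_mono hn.le)

end BanachBundle

/-! ### The equivalence and the two bounds -/

theorem theorem3p5 :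
    -- the functions `φ p`, which depend on `p` alone
    ∃ φ : ℝ≥0∞ → ℝ → ℝ → ℝ,
      (∀ p : ℝ≥0∞, 1 < p → p ≠ ∞ →
        ContinuousOn (fun z : ℝ × ℝ => φ p z.1 z.2) (Ioc 0 2 ×ˢ Ioc 0 1) ∧
        (∀ ε ∈ Ioc (0 : ℝ) 2, ∀ t ∈ Ioc (0 : ℝ) 1, φ p ε t ∈ Ioc (0 : ℝ) 1) ∧
        (∀ ε ∈ Ioc (0 : ℝ) 2, MonotoneOn (fun t => φ p ε t) (Ioc 0 1)) ∧
        (∀ t ∈ Ioc (0 : ℝ) 1, MonotoneOn (fun ε => φ p ε t) (Ioc 0 2)) ∧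
        -- the convention at `t = 0`
        (∀ ε ∈ Ioc (0 : ℝ) 2, φ p ε 0 = 0)) ∧
      ∀ (X : Type u) [MeasurableSpace X] (μ : Measure X) [SigmaFinite μ]
        (B : Type v) [NormedAddCommGroup B] [NormedSpace ℝ B] [CompleteSpace B]
        [SeparableSpace B] (E : BanachBundle X B),
        ((E.IsUniformlyConvexBundle μ ∧ ∀ ε ∈ Ioc (0 : ℝ) 2,
            0 < BanachBundle.essInfReal μ (fun x => modulusOfConvexity (E.fiber x) ε)) ↔
          ∀ (p : ℝ≥0∞) [Fact (1 ≤ p)], 1 < p → p ≠ ∞ →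
            IsUniformlyConvex (E.sectionSpace p μ)) ∧
        ∀ (p : ℝ≥0∞) [Fact (1 ≤ p)], 1 < p → p ≠ ∞ → ∀ ε ∈ Ioc (0 : ℝ) 2,
          (μ ≠ 0 →
            BanachBundle.essInfReal μ (fun x => φ p ε (modulusOfConvexity (E.fiber x) (ε / 5))) ≤
              (modulusOfConvexity (E.sectionSpace p μ) ε : EReal)) ∧
          (modulusOfConvexity (E.sectionSpace p μ) ε : EReal) ≤
            BanachBundle.essInfReal μ (fun x => modulusOfConvexity (E.fiber x) ε) := by
  refine ⟨fun p ε t => t * convexityRate p.toReal ε, fun p hp1 hp => ?_, ?_⟩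
  · have hq : 1 < p.toReal := ENNReal.one_lt_toReal hp1 hp
    refine ⟨?_, fun ε hε t ht => ⟨?_, ?_⟩, fun ε hε a _ b _ hab => ?_, fun t ht a ha b hb hab => ?_,
      fun ε _ => zero_mul _⟩
    · exact continuousOn_snd.mul
        ((convexityRate_continuousOn hq).comp continuousOn_fst fun z hz => hz.1)
    · exact mul_pos ht.1 (convexityRate_pos hq hε)
    · exact mul_le_one₀ ht.2 (convexityRate_pos hq hε).le (convexityRate_le_one hq hε)
    · exact mul_le_mul_of_nonneg_right hab (convexityRate_pos hq hε).le
    · exact mul_le_mul_of_nonneg_left (convexityRate_monotoneOn hq ha hb hab) ht.1.le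
  · intro X _ μ _ B _ _ _ _ E
    refine ⟨⟨fun h p _ hp1 hp => BanachBundle.isUniformlyConvex_sectionSpace hp1 hp h.2,
      fun h => ?_⟩, fun p _ hp1 hp ε hε =>
        ⟨fun hμ => BanachBundle.essInfReal_mul_convexityRate_le hμ hp1 hp hε,
          BanachBundle.modulusOfConvexity_sectionSpace_le_essInfReal hp1 hp⟩⟩
    have hpos : ∀ ε ∈ Ioc (0 : ℝ) 2,
        0 < BanachBundle.essInfReal μ fun x => modulusOfConvexity (E.fiber x) ε := fun ε hε =>
      (EReal.coe_pos.2 (h 2 (by norm_num) (by norm_num) ε hε)).trans_le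
        (BanachBundle.modulusOfConvexity_sectionSpace_le_essInfReal (by norm_num) (by norm_num))
    exact ⟨BanachBundle.isUniformlyConvexBundle_of_essInfReal_pos hpos, hpos⟩
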